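/- For a positive integer $n$ write the $n$-th cyclotomic polynomial as $\Phi_n(x)=\sum_{k\ge 0}a_n(k)x^k$ and let $\mathcal C(n)=\{a_n(k):0\le k\le \deg\Phi_n\}$ be its set of coefficients. For primes $p<q<r$ we call $\Phi_{pqr}$ coefficient optimal if the difference between its largest and its smallest coefficient is exactly $p$. (a) Let $p<q<r$ be primes with $p>3$, $q\equiv 2 \pmod p$, $r\equiv \frac{p-1}{2}\pmod p$ and $r\equiv\frac{q-1}{2}\pmod q$, and put $n=pqr$ and $k=(p-1)(qr+1)/2$. Then $\Phi_n$ is coefficient optimal and $$\mathcal C(n)=\{a_n(k-r),a_n(k-r+1),\ldots,a_n(k)\}=\left[-\tfrac{p-1}{2},\tfrac{p+1}{2}\right]\cap\mathbb Z .$$ (b) Let $p<q<r_1$ be primes with $p>3$, $q\equiv 2 \pmod p$, $r_1\equiv \frac{p+1}{2}\pmod p$ and $r_1\equiv\frac{q+1}{2}\pmod q$, and put $n_1=pqr_1$ and $k_1=(p-1)(qr_1+1)/2+q$. Then $\Phi_{n_1}$ is coefficient optimal and $$\mathcal C(n_1)=\{a_{n_1}(k_1-r_1),a_{n_1}(k_1-r_1+1),\ldots,a_{n_1}(k_1)\}=\left[-\tfrac{p+1}{2},\tfrac{p-1}{2}\right]\cap\mathbb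 Z .$$ -/

import Mathlib

/-- `cyclotomicCoeff n k` is the coefficient `a_n(k)` of `x ^ k` in the `n`-th cyclotomic
polynomial `Φ_n`, viewed in `ℤ[x]`. -/
noncomputable def cyclotomicCoeff (n k : ℕ) : ℤ :=
  (Polynomial.cyclotomic n ℤ).coeff k

/-- The coefficient set `C(n) = {a_n(k) : 0 ≤ k ≤ deg Φ_n}` of the `n`-th cyclotomic polynomial. -/
def cyclotomicCoeffSet (n : ℕ) : Set ℤ :=
  {c | ∃ k : ℕ, k ≤ (Polynomial.cyclotomic n ℤ).natDegree ∧ cyclotomicCoeff n k = c}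

/-- For primes `p < q < r`, the ternary cyclotomic polynomial `Φ_{pqr}` is coefficient optimal if
the difference between its largest and its smallest coefficient is exactly `p`. -/
def IsCoefficientOptimal (p q r : ℕ) : Prop :=
  ∃ M m : ℤ, IsGreatest (cyclotomicCoeffSet (p * q * r)) M ∧
    IsLeast (cyclotomicCoeffSet (p * q * r)) m ∧ M - m = (p : ℤ)

/-!
Write `a` for the coefficients of `Φ_{pq}` and let `n = pqr`. From
`Φ_n(x) (x - 1) (x^{pq} - 1) = Φ_{pq}(x^r) (x^p - 1) (x^q - 1)` one reads off Kaplan's formula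
(`intCoeff_cyclotomic_eq_sum_truncCoeff`): `a_n(k)` is the sum over `m < p` of
`b(f(m)) - b(f(m + q))`, where `f(m)` is the residue of `(k - m) / r` modulo `pq` and `b(j)` is
`a(j)` for `j ≤ k / r` and `0` for larger `j`. The coefficients of `Φ_{pq}` are explicit: choose
positive `μ, ν` with `μ p + ν q = pq + 1` and write `j ≡ u p + v q` modulo `pq` with `0 ≤ u < q`,
`0 ≤ v < p`; then `a(j) = [u < μ] - [ν ≤ v]` (`truncCoeff_cyclotomic_eq_gridCoeff`).

Three consequences give the theorem.

* Neighbouring coefficients of `Φ_n` differ by at most one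
  (`abs_intCoeff_cyclotomic_sub_le`), because the difference is an alternating sum of `b` over the
  corners of a rectangle in the coordinates `(u, v)`. So the coefficients between two positions
  take every intermediate value.
* The congruences for `r` say that the inverse of `r` modulo `pq` is `-2` in the first case and `2`
  in the second, and `q ≡ 2` modulo `p` gives `ν = (p + 1) / 2`. Passing from `f(m)` to `f(m + q)`
  therefore moves `v` by `2` and fixes `u`, so that, up to a global sign, each term of Kaplan's sum
  lies in `{0, 1}` if `v < ν` and in `{-1, 0}` otherwise. As `v` runs over all residues modulo `p`,
  the sum lies between `ν - p` and `ν` (`windowSum_bounds`), an interval of length `p`.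
* Both bounds are attained, at `k` and at `k - r`: there the truncation point `k / r` is the middle
  of the arithmetic progression `f(0), …, f(p - 1)` (in the second case, of
  `f(q), …, f(q + p - 1)`), and the coefficients of `Φ_{pq}` in its lower half are all `1` at `k`
  and all but one `-1` at `k - r` (`windowSum_eq_max`, `windowSum_eq_min`).
-/

section

open Polynomial Finset

/-! ### Coefficients with integer exponents -/

/-- The coefficient of `x ^ k` in `P`, for an integer exponent `k`; it is zero for `k < 0`. -/
noncomputable def intCoeff (P : ℤ[X]) (k : ℤ) : ℤ :=
  if 0 ≤ k then P.coeff k.toNat else 0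

lemma intCoeff_natCast (P : ℤ[X]) (k : ℕ) : intCoeff P k = P.coeff k := by
  simp [intCoeff]

lemma intCoeff_of_neg (P : ℤ[X]) {k : ℤ} (hk : k < 0) : intCoeff P k = 0 := by
  simp [intCoeff, hk]

lemma intCoeff_mul_X_pow_sub_one (P : ℤ[X]) (n : ℕ) (k : ℤ) :
    intCoeff (P * (X ^ n - 1)) k = intCoeff P (k - n) - intCoeff P k := by
  rcases lt_or_ge k 0 with hk | hk
  · rw [intCoeff_of_neg _ hk, intCoeff_of_neg _ hk, intCoeff_of_neg _ (by omega), sub_zero]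
  · lift k to ℕ using hk
    rw [intCoeff_natCast, intCoeff_natCast, mul_sub, mul_one, coeff_sub, coeff_mul_X_pow']
    split_ifs with h
    · rw [← Nat.cast_sub h, intCoeff_natCast]
    · rw [intCoeff_of_neg _ (by omega)]

lemma intCoeff_expand (P : ℤ[X]) {r : ℕ} (hr : 0 < r) (k : ℤ) :
    intCoeff (expand ℤ r P) k = if (r : ℤ) ∣ k then intCoeff P (k / r) else 0 := by
  rcases lt_or_ge k 0 with hk | hk
  · rw [intCoeff_of_neg _ hk, intCoeff_of_neg _ (Int.ediv_neg_of_neg_of_pos hk (by omega))]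
    simp
  · lift k to ℕ using hk
    rw [intCoeff_natCast, coeff_expand hr, ← Int.natCast_div, intCoeff_natCast]
    simp only [Int.natCast_dvd_natCast]

lemma intCoeff_eq_zero_of_natDegree_lt {P : ℤ[X]} {k : ℤ} (hk : (P.natDegree : ℤ) < k) :
    intCoeff P k = 0 := by
  lift k to ℕ using by omega
  rw [intCoeff_natCast]
  exact coeff_eq_zero_of_natDegree_lt (by exact_mod_cast hk)

/-- A periodic function on `ℤ` that vanishes on the negative integers is zero. This replaces
division by `1 - x ^ N` in the ring of power series. -/
lemma eq_zero_of_periodic {N : ℤ} (hN : 0 < N) {h : ℤ → ℤ} (hneg : ∀ k < 0, h k = 0)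
    (hper : ∀ k, h k = h (k - N)) (k : ℤ) : h k = 0 := by
  have key : ∀ n : ℕ, ∀ k : ℤ, k < n * N → h k = 0 := by
    intro n
    induction n with
    | zero => intro k hk; exact hneg k (by simpa using hk)
    | succ n ih =>
      intro k hk
      rw [hper]
      apply ih
      push_cast at hk
      linarith
  refine key (k.toNat + 1) k ?_
  have : k ≤ k.toNat := Int.self_le_toNat k
  push_cast
  nlinarith

/-! ### The power series `P(x ^ r) / (1 - x ^ M)` -/

/-- The coefficient of `x ^ k` in the power series `P(x ^ r) / (1 - x ^ M)`, when `deg P < M` and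
`s` is an inverse of `r` modulo `M`: the only exponent `r * j` with `j < M` that is congruent to
`k` modulo `M` is the one with `j = s * k % M`. -/
noncomputable def quotCoeff (P : ℤ[X]) (M r s k : ℤ) : ℤ :=
  if r * (s * k % M) ≤ k then intCoeff P (s * k % M) else 0

lemma quotCoeff_of_neg (P : ℤ[X]) {M r : ℤ} (s : ℤ) {k : ℤ} (hM : 0 < M) (hr : 0 ≤ r)
    (hk : k < 0) : quotCoeff P M r s k = 0 := by
  have := mul_nonneg hr (Int.emod_nonneg (s * k) hM.ne')
  rw [quotCoeff, if_neg (by omega)]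

lemma modEq_mul_inverse {M r s : ℤ} (hs : s * r ≡ 1 [ZMOD M]) (k : ℤ) :
    r * (s * k % M) ≡ k [ZMOD M] :=
  calc r * (s * k % M) ≡ r * (s * k) [ZMOD M] := (Int.mod_modEq _ _).mul_left r
    _ = s * r * k := by ring
    _ ≡ 1 * k [ZMOD M] := hs.mul_right k
    _ = k := one_mul k

lemma quotCoeff_sub_quotCoeff {P : ℤ[X]} {M s : ℤ} {r : ℕ} (hM : (P.natDegree : ℤ) < M)
    (hr : 0 < r) (hs : s * r ≡ 1 [ZMOD M]) (k : ℤ) :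
    quotCoeff P M r s k - quotCoeff P M r s (k - M) = intCoeff (expand ℤ r P) k := by
  have hM0 : 0 < M := by omega
  have hJ : s * (k - M) % M = s * k % M :=
    Int.ModEq.mul_left s (show k - M ≡ k [ZMOD M] by simp [Int.ModEq])
  have hJk := modEq_mul_inverse hs k
  rw [intCoeff_expand P hr, quotCoeff, quotCoeff, hJ]
  have h0 := Int.emod_nonneg (s * k) hM0.ne'
  have h1 := Int.emod_lt_of_pos (s * k) hM0
  have hr' : (0 : ℤ) < r := by exact_mod_cast hr
  by_cases hdvd : (r : ℤ) ∣ k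
  · obtain ⟨j, rfl⟩ := hdvd
    rw [if_pos (dvd_mul_right _ _), Int.mul_ediv_cancel_left _ hr'.ne']
    have hj : s * (r * j) % M = j % M := by
      have := hs.mul_right j
      rw [one_mul, mul_assoc] at this
      exact this
    by_cases hjM : 0 ≤ j ∧ j < M
    · rw [hj, Int.emod_eq_of_lt hjM.1 hjM.2, if_pos le_rfl, if_neg (by omega), sub_zero]
    · have : intCoeff P j = 0 := by
        rcases lt_or_ge j 0 with h | h
        · exact intCoeff_of_neg P h
        · exact intCoeff_eq_zero_of_natDegree_lt (by omega)
      rw [this]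
      rcases lt_or_ge j 0 with h | h
      · have : (r : ℤ) * j < 0 := mul_neg_of_pos_of_neg hr' h
        have := mul_nonneg hr'.le h0
        rw [if_neg (by omega), if_neg (by omega), sub_zero]
      · obtain ⟨c, hc⟩ := hJk.dvd
        have h2 : r * (s * (r * j) % M) < r * j := by
          apply mul_lt_mul_of_pos_left _ hr'
          omega
        have : 0 < c := by
          by_contra hcon
          nlinarith
        rw [if_pos h2.le, if_pos (by nlinarith), sub_self]
  · rw [if_neg hdvd]
    obtain ⟨c, hc⟩ := hJk.dvd
    have hc0 : c ≠ 0 := by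
      rintro rfl
      exact hdvd ⟨s * k % M, by linarith⟩
    rcases lt_or_gt_of_ne hc0 with h | h
    · rw [if_neg (by nlinarith), if_neg (by nlinarith), sub_zero]
    · rw [if_pos (by nlinarith), if_pos (by nlinarith), sub_self]

/-- The coefficient of `P` at the residue of `j` modulo `M`, replaced by zero when that residue
exceeds `K`. -/
noncomputable def truncCoeff (P : ℤ[X]) (M K j : ℤ) : ℤ :=
  if j % M ≤ K then intCoeff P (j % M) else 0

lemma truncCoeff_congr (P : ℤ[X]) {M j j' : ℤ} (K : ℤ) (h : j ≡ j' [ZMOD M]) :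
    truncCoeff P M K j = truncCoeff P M K j' := by
  rw [truncCoeff, truncCoeff, h]

lemma truncCoeff_eq_zero (P : ℤ[X]) {M K j : ℤ} (h0 : 0 ≤ j) (hM : j < M) (hK : K < j) :
    truncCoeff P M K j = 0 := by
  rw [truncCoeff, Int.emod_eq_of_lt h0 hM, if_neg (by omega)]

/-- Within a window of length `M` the truncation condition does not depend on the shift. -/
lemma quotCoeff_sub_eq_truncCoeff (P : ℤ[X]) {M r s : ℤ} (hr : 0 < r)
    (hs : s * r ≡ 1 [ZMOD M]) {k m : ℤ} (hm : 0 ≤ m) (hmM : m < M) :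
    quotCoeff P M r s (k - m) = truncCoeff P M (k / r) (s * (k - m)) := by
  rw [quotCoeff, truncCoeff]
  refine if_congr ?_ rfl rfl
  rw [Int.le_ediv_iff_mul_le hr, mul_comm]
  obtain ⟨c, hc⟩ := (modEq_mul_inverse hs (k - m)).dvd
  constructor
  · intro h; linarith
  · intro h
    by_contra hcon
    have : c ≤ -1 := by
      by_contra hc'
      have : 0 ≤ M * c := mul_nonneg (by omega) (by omega)
      linarith
    nlinarith

/-! ### Cyclotomic polynomials of orders `p * q` and `p * q * r` -/

lemma cyclotomic_mul_mul_X_pow_sub_one {p q : ℕ} (hp : p.Prime) (hq : q.Prime) (hpq : p ≠ q) :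
    cyclotomic (p * q) ℤ * (X ^ p - 1) = expand ℤ q (cyclotomic p ℤ) * (X ^ 1 - 1) := by
  have h := cyclotomic_expand_eq_cyclotomic_mul (n := p) hq
    (by rwa [Nat.prime_dvd_prime_iff_eq hq hp, eq_comm]) ℤ
  have h' := cyclotomic_prime_mul_X_sub_one ℤ p (hn := ⟨hp⟩)
  rw [h, ← h', pow_one]
  ring

lemma expand_cyclotomic_prime_mul {p q : ℕ} (hp : p.Prime) :
    expand ℤ q (cyclotomic p ℤ) * (X ^ q - 1) = X ^ (p * q) - 1 := by
  have h' := congrArg (expand ℤ q) (cyclotomic_prime_mul_X_sub_one ℤ p (hn := ⟨hp⟩))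
  simpa [← pow_mul, mul_comm q p] using h'

lemma cyclotomic_mul_mul_mul_X_pow_sub_one {p q r : ℕ} (hp : p.Prime) (hq : q.Prime)
    (hr : r.Prime) (hpq : p ≠ q) (hpr : p ≠ r) (hqr : q ≠ r) :
    cyclotomic (p * q * r) ℤ * (X ^ 1 - 1) * (X ^ (p * q) - 1) =
      expand ℤ r (cyclotomic (p * q) ℤ) * (X ^ p - 1) * (X ^ q - 1) := by
  have hdvd : ¬ r ∣ p * q := by
    rw [hr.dvd_mul, Nat.prime_dvd_prime_iff_eq hr hp, Nat.prime_dvd_prime_iff_eq hr hq]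
    tauto
  rw [cyclotomic_expand_eq_cyclotomic_mul hr hdvd ℤ, ← expand_cyclotomic_prime_mul hp,
    mul_assoc _ _ (X ^ p - 1), cyclotomic_mul_mul_X_pow_sub_one hp hq hpq]
  ring

lemma intCoeff_cyclotomic_prime {p : ℕ} (hp : p.Prime) {j : ℤ} (h0 : 0 ≤ j) (hj : j < p) :
    intCoeff (cyclotomic p ℤ) j = 1 := by
  lift j to ℕ using h0
  have := Fact.mk hp
  rw [intCoeff_natCast, cyclotomic_prime, finsetSum_coeff]
  have : j < p := by exact_mod_cast hj
  simp [coeff_X_pow, this]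

lemma natDegree_cyclotomic_lt {n : ℕ} (hn : 1 < n) : (cyclotomic n ℤ).natDegree < n := by
  rw [natDegree_cyclotomic]
  exact Nat.totient_lt n hn

/-- The `k`-th coefficient of `Φ_{pq}` is `[k ∈ S] - [k - 1 ∈ S]`, where `S` is the numerical
semigroup generated by `p` and `q`, and `ν` is an inverse of `q` modulo `p`. -/
lemma intCoeff_cyclotomic_mul {p q : ℕ} (hp : p.Prime) (hq : q.Prime) (hpq : p ≠ q) {ν : ℤ}
    (hν : ν * q ≡ 1 [ZMOD p]) (k : ℤ) :
    intCoeff (cyclotomic (p * q) ℤ) k =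
      (if q * (ν * k % p) ≤ k then 1 else 0) -
        (if q * (ν * (k - 1) % p) ≤ k - 1 then 1 else 0) := by
  have hp0 : (0 : ℤ) < p := by exact_mod_cast hp.pos
  have hN : ∀ k : ℤ, quotCoeff (cyclotomic p ℤ) p q ν k =
      if q * (ν * k % p) ≤ k then 1 else 0 := by
    intro k
    rw [quotCoeff, intCoeff_cyclotomic_prime hp (Int.emod_nonneg _ hp0.ne')
      (Int.emod_lt_of_pos _ hp0)]
  rw [← hN, ← hN, ← sub_eq_zero]
  refine eq_zero_of_periodic hp0 (h := fun k ↦ intCoeff (cyclotomic (p * q) ℤ) k -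
    (quotCoeff (cyclotomic p ℤ) p q ν k - quotCoeff (cyclotomic p ℤ) p q ν (k - 1))) ?_ ?_ k
  · intro k hk
    rw [intCoeff_of_neg _ hk, quotCoeff_of_neg _ _ hp0 (by positivity) hk,
      quotCoeff_of_neg _ _ hp0 (by positivity) (by omega)]
    simp
  · intro k
    have hdeg : ((cyclotomic p ℤ).natDegree : ℤ) < p := by
      exact_mod_cast natDegree_cyclotomic_lt hp.one_lt
    have h1 := quotCoeff_sub_quotCoeff hdeg hq.pos hν k
    have h2 := quotCoeff_sub_quotCoeff hdeg hq.pos hν (k - 1)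
    have h3 := congrArg (intCoeff · k) (cyclotomic_mul_mul_X_pow_sub_one hp hq hpq)
    simp only [intCoeff_mul_X_pow_sub_one, Nat.cast_one] at h3
    rw [sub_right_comm k p 1]
    linarith

/-- The first differences of the coefficients of `Φ_{pqr}`. -/
lemma intCoeff_cyclotomic_sub {p q r : ℕ} (hp : p.Prime) (hq : q.Prime)
    (hr : r.Prime) (hpq : p ≠ q) (hpr : p ≠ r) (hqr : q ≠ r) {s : ℤ}
    (hs : s * r ≡ 1 [ZMOD (p * q : ℕ)]) (k : ℤ) :
    intCoeff (cyclotomic (p * q * r) ℤ) k - intCoeff (cyclotomic (p * q * r) ℤ) (k - 1) =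
      quotCoeff (cyclotomic (p * q) ℤ) (p * q : ℕ) r s k
      - quotCoeff (cyclotomic (p * q) ℤ) (p * q : ℕ) r s (k - p)
      - quotCoeff (cyclotomic (p * q) ℤ) (p * q : ℕ) r s (k - q)
      + quotCoeff (cyclotomic (p * q) ℤ) (p * q : ℕ) r s (k - q - p) := by
  have hM : 0 < p * q := Nat.mul_pos hp.pos hq.pos
  have hM0 : (0 : ℤ) < (p * q : ℕ) := by exact_mod_cast hM
  have hdeg : ((cyclotomic (p * q) ℤ).natDegree : ℤ) < (p * q : ℕ) := by
    exact_mod_cast natDegree_cyclotomic_lt (by nlinarith [hp.two_le, hq.two_le])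
  set M : ℤ := ((p * q : ℕ) : ℤ) with hMdef
  set G := quotCoeff (cyclotomic (p * q) ℤ) M r s
  have hG : ∀ k < 0, G k = 0 := fun k hk ↦
    quotCoeff_of_neg _ _ hM0 (by positivity) hk
  rw [← sub_eq_zero]
  refine eq_zero_of_periodic hM0 (h := fun k ↦ intCoeff (cyclotomic (p * q * r) ℤ) k -
    intCoeff (cyclotomic (p * q * r) ℤ) (k - 1) -
      (G k - G (k - p) - G (k - q) + G (k - q - p))) ?_ ?_ k
  · intro k hk
    rw [intCoeff_of_neg _ hk, intCoeff_of_neg _ (by omega), hG _ hk, hG _ (by omega),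
      hG _ (by omega), hG _ (by omega)]
    simp
  · intro k
    have h1 : ∀ k, G k - G (k - M) = intCoeff (expand ℤ r (cyclotomic (p * q) ℤ)) k :=
      quotCoeff_sub_quotCoeff hdeg hr.pos hs
    have h3 := congrArg (intCoeff · k)
      (cyclotomic_mul_mul_mul_X_pow_sub_one hp hq hr hpq hpr hqr)
    simp only [intCoeff_mul_X_pow_sub_one, Nat.cast_one, ← h1, ← hMdef] at h3
    rw [sub_right_comm k M p, sub_right_comm k M q, sub_right_comm k M 1,
      sub_right_comm (k - q) M p]
    rw [sub_right_comm k M 1] at h3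
    linarith

/-- Kaplan's formula for the coefficients of `Φ_{pqr}`. -/
lemma intCoeff_cyclotomic_eq_sum {p q r : ℕ} (hp : p.Prime) (hq : q.Prime)
    (hr : r.Prime) (hpq : p ≠ q) (hpr : p ≠ r) (hqr : q ≠ r) {s : ℤ}
    (hs : s * r ≡ 1 [ZMOD (p * q : ℕ)]) (k : ℤ) :
    intCoeff (cyclotomic (p * q * r) ℤ) k = ∑ m ∈ range p,
      (quotCoeff (cyclotomic (p * q) ℤ) (p * q : ℕ) r s (k - m)
      - quotCoeff (cyclotomic (p * q) ℤ) (p * q : ℕ) r s (k - q - m)) := by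
  have hM : 0 < p * q := Nat.mul_pos hp.pos hq.pos
  have hM0 : (0 : ℤ) < (p * q : ℕ) := by exact_mod_cast hM
  have hdiff := intCoeff_cyclotomic_sub hp hq hr hpq hpr hqr hs
  set M : ℤ := ((p * q : ℕ) : ℤ) with hMdef
  set G := quotCoeff (cyclotomic (p * q) ℤ) M r s
  have hG : ∀ k < 0, G k = 0 := fun k hk ↦
    quotCoeff_of_neg _ _ hM0 (by positivity) hk
  rw [← sub_eq_zero]
  refine eq_zero_of_periodic one_pos (h := fun k ↦ intCoeff (cyclotomic (p * q * r) ℤ) k -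
    ∑ m ∈ range p, (G (k - m) - G (k - q - m))) ?_ ?_ k
  · intro k hk
    rw [intCoeff_of_neg _ hk, sum_eq_zero, sub_zero]
    intro m _
    rw [hG _ (by omega), hG _ (by omega), sub_zero]
  · intro k
    have htel := sum_range_sub' (fun m : ℕ ↦ G (k - m) - G (k - q - m)) p
    rw [sum_sub_distrib] at htel
    have hshift : ∀ m ∈ range p, G (k - 1 - m) - G (k - 1 - q - m) =
        G (k - (m + 1 : ℕ)) - G (k - q - (m + 1 : ℕ)) := by
      intro m _
      push_cast
      congr 2 <;> ring
    rw [sum_congr rfl hshift]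
    have := hdiff k
    simp only [Nat.cast_zero, sub_zero] at htel
    linarith

/-! ### Grid coordinates for the coefficients of `Φ_{pq}` -/

/-- The values of `truncCoeff` for `Φ_{pq}` in the coordinates `(u, v)` of the exponent
`u * p + v * q`, where `0 ≤ u < q` and `0 ≤ v < p`. -/
def gridCoeff (p q μ ν K u v : ℤ) : ℤ :=
  if u < μ then (if v < ν then (if u * p + v * q ≤ K then 1 else 0) else 0)
  else (if v < ν then 0 else (if u * p + v * q - p * q ≤ K then -1 else 0))

section Grid

variable {p q : ℕ} {μ ν : ℤ}

/-- The coefficients of `Φ_{pq}`: the exponents with coefficient `1` are `u * p + v * q` with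
`u < μ`, `v < ν`, those with coefficient `-1` are `u * p + v * q - p * q` with `μ ≤ u`, `ν ≤ v`. -/
lemma truncCoeff_cyclotomic_eq_gridCoeff (hp : p.Prime) (hq : q.Prime) (hpq : p ≠ q)
    (hμν : μ * p + ν * q = p * q + 1) (hμ : 0 < μ) (hν : 0 < ν) {u v : ℤ} (hu0 : 0 ≤ u)
    (huq : u < q) (hv0 : 0 ≤ v) (hvp : v < p) (K : ℤ) {j : ℤ}
    (hj : j ≡ u * p + v * q [ZMOD (p * q : ℕ)]) :
    truncCoeff (cyclotomic (p * q) ℤ) (p * q : ℕ) K j = gridCoeff p q μ ν K u v := by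
  have hp0 : (0 : ℤ) < p := by exact_mod_cast hp.pos
  have hq0 : (0 : ℤ) < q := by exact_mod_cast hq.pos
  have hνp : ν ≤ p := by
    by_contra hcon
    nlinarith
  have hνq : ν * q ≡ 1 [ZMOD p] :=
    (Int.modEq_iff_dvd.2 ⟨q - μ, by linarith⟩ : (1 : ℤ) ≡ ν * q [ZMOD p]).symm
  have hmod : ∀ w e : ℤ, 0 ≤ w → w < p → ν * (w * q + p * e) % p = w := by
    intro w e hw hwp
    have : ν * (w * q + p * e) ≡ w [ZMOD p] := by
      have h1 := hνq.mul_left w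
      have h2 : ν * (w * q + p * e) = w * (ν * q) + p * (ν * e) := by ring
      rw [h2, Int.ModEq, Int.add_mul_emod_self_left]
      rw [mul_one] at h1
      exact h1
    rw [this, Int.emod_eq_of_lt hw hwp]
  -- `1 = μ * p + ν * q - p * q` gives the coordinates of `j - 1` from those of `j`.
  have hval : ∀ ε : ℤ, intCoeff (cyclotomic (p * q) ℤ) (u * p + v * q - ε * (p * q)) =
      (if 0 ≤ u - ε * q then 1 else 0) -
        (if ν ≤ v then (if 0 ≤ u + q - μ - ε * q then 1 else 0)
          else (if 0 ≤ u - μ - ε * q then 1 else 0)) := by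
    intro ε
    rw [intCoeff_cyclotomic_mul hp hq hpq hνq]
    congr 1
    · rw [show u * p + v * q - ε * (p * q) = v * q + p * (u - ε * q) by ring,
        hmod v _ hv0 hvp]
      refine if_congr ?_ rfl rfl
      rw [mul_comm (q : ℤ) v, le_add_iff_nonneg_right, mul_nonneg_iff_of_pos_left hp0]
    · by_cases hvν : ν ≤ v
      · rw [if_pos hvν, show u * p + v * q - ε * (p * q) - 1 = (v - ν) * q + p * (u + q - μ - ε * q) by
          linarith, hmod _ _ (by omega) (by omega)]
        refine if_congr ?_ rfl rfl
        rw [mul_comm (q : ℤ) (v - ν), le_add_iff_nonneg_right, mul_nonneg_iff_of_pos_left hp0]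
      · rw [if_neg hvν, show u * p + v * q - ε * (p * q) - 1 = (v - ν + p) * q + p * (u - μ - ε * q) by
          linarith, hmod _ _ (by omega) (by omega)]
        refine if_congr ?_ rfl rfl
        rw [mul_comm (q : ℤ) (v - ν + p), le_add_iff_nonneg_right,
          mul_nonneg_iff_of_pos_left hp0]
  have hμq : μ ≤ q := by
    by_contra hcon
    nlinarith
  have hup : 0 ≤ u * p := by positivity
  have hvq : 0 ≤ v * q := by positivity
  have hup' : u * p ≤ p * q - p := by nlinarith
  have hvq' : v * q ≤ p * q - q := by nlinarith
  rw [truncCoeff_congr _ _ hj, truncCoeff, gridCoeff]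
  push_cast
  rcases lt_or_ge (u * p + v * q) ((p : ℤ) * q) with h | h
  · have := hval 0
    rw [zero_mul, zero_mul, sub_zero] at this
    rw [Int.emod_eq_of_lt (by omega) h, this]
    have hne : ¬ (μ ≤ u ∧ ν ≤ v) := by
      rintro ⟨h1, h2⟩
      nlinarith
    split_ifs <;> omega
  · have := hval 1
    rw [one_mul, one_mul] at this
    have hemod : (u * p + v * q) % ((p : ℤ) * q) = u * p + v * q - p * q := by
      rw [← Int.sub_emod_right, Int.emod_eq_of_lt (by omega) (by omega)]
    rw [hemod, this]
    have hne : ¬ (u < μ ∧ v < ν) := by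
      rintro ⟨h1, h2⟩
      nlinarith
    split_ifs <;> omega

lemma truncCoeff_cyclotomic_eq_gridCoeff_emod (hp : p.Prime) (hq : q.Prime) (hpq : p ≠ q)
    (hμν : μ * p + ν * q = p * q + 1) (hμ : 0 < μ) (hν : 0 < ν) (K j : ℤ) :
    truncCoeff (cyclotomic (p * q) ℤ) (p * q : ℕ) K j =
      gridCoeff p q μ ν K (j * μ % q) (j * ν % p) := by
  have hp0 : (0 : ℤ) < p := by exact_mod_cast hp.pos
  have hq0 : (0 : ℤ) < q := by exact_mod_cast hq.pos
  refine truncCoeff_cyclotomic_eq_gridCoeff hp hq hpq hμν hμ hν (Int.emod_nonneg _ hq0.ne')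
    (Int.emod_lt_of_pos _ hq0) (Int.emod_nonneg _ hp0.ne') (Int.emod_lt_of_pos _ hp0) K ?_
  have h1 := Int.emod_add_mul_ediv (j * μ) q
  have h2 := Int.emod_add_mul_ediv (j * ν) p
  refine (Int.modEq_iff_dvd.2 ⟨j * μ / q + j * ν / p - j, ?_⟩ : _ ≡ j [ZMOD _]).symm
  push_cast
  linear_combination (-p : ℤ) * h1 - q * h2 - j * hμν

/-- An alternating sum over the corners of a rectangle. For `K` large it vanishes, because
`[u < μ] - [ν ≤ v]` separates the variables; the truncation costs at most one, because the two
diagonals have equal exponent sums. -/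
lemma abs_gridCoeff_rectangle_le (p q μ ν K u u' v v' : ℤ) :
    |gridCoeff p q μ ν K u v - gridCoeff p q μ ν K u' v - gridCoeff p q μ ν K u v'
      + gridCoeff p q μ ν K u' v'| ≤ 1 := by
  rw [abs_le]
  unfold gridCoeff
  generalize u * p = a
  generalize u' * p = a'
  generalize v * q = b
  generalize v' * q = b'
  generalize p * q = c
  by_cases h1 : u < μ <;> by_cases h2 : u' < μ <;> by_cases h3 : v < ν <;>
    by_cases h4 : v' < ν <;>
    simp only [h1, h2, h3, h4, if_true, if_false] <;>
    constructor <;> (try split_ifs) <;> omega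

end Grid

/-- Neighbouring coefficients of a ternary cyclotomic polynomial differ by at most one. -/
lemma abs_intCoeff_cyclotomic_sub_le {p q r : ℕ} (hp : p.Prime) (hq : q.Prime)
    (hr : r.Prime) (hpq : p ≠ q) (hpr : p ≠ r) (hqr : q ≠ r) {s μ ν : ℤ}
    (hs : s * r ≡ 1 [ZMOD (p * q : ℕ)])
    (hμν : μ * p + ν * q = p * q + 1) (hμ : 0 < μ) (hν : 0 < ν) (k : ℤ) :
    |intCoeff (cyclotomic (p * q * r) ℤ) k - intCoeff (cyclotomic (p * q * r) ℤ) (k - 1)| ≤ 1 := by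
  have hp2 : (2 : ℤ) ≤ p := by exact_mod_cast hp.two_le
  have hq2 : (2 : ℤ) ≤ q := by exact_mod_cast hq.two_le
  have hr0 : (0 : ℤ) < r := by exact_mod_cast hr.pos
  have hpq' : (p + q : ℤ) < (p * q : ℕ) := by
    push_cast
    rcases lt_or_gt_of_ne hpq with h | h
    · have : (p + 1 : ℤ) ≤ q := by exact_mod_cast h
      nlinarith
    · have : (q + 1 : ℤ) ≤ p := by exact_mod_cast h
      nlinarith
  rw [intCoeff_cyclotomic_sub hp hq hr hpq hpr hqr hs, sub_sub k q p]
  have h0 := quotCoeff_sub_eq_truncCoeff (cyclotomic (p * q) ℤ) hr0 hs (k := k) le_rfl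
    (by omega)
  rw [sub_zero] at h0
  rw [h0, quotCoeff_sub_eq_truncCoeff _ hr0 hs (by omega) (by omega),
    quotCoeff_sub_eq_truncCoeff _ hr0 hs (by omega) (by omega),
    quotCoeff_sub_eq_truncCoeff _ hr0 hs (by omega) (by omega)]
  simp only [truncCoeff_cyclotomic_eq_gridCoeff_emod hp hq hpq hμν hμ hν]
  have e1 : s * (k - p) * ν % p = s * k * ν % p := by
    rw [show s * (k - p) * ν = s * k * ν - p * (s * ν) by ring, Int.sub_mul_emod_self_left]
  have e2 : s * (k - q) * μ % q = s * k * μ % q := by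
    rw [show s * (k - q) * μ = s * k * μ - q * (s * μ) by ring, Int.sub_mul_emod_self_left]
  have e3 : s * (k - (q + p)) * μ % q = s * (k - p) * μ % q := by
    rw [show s * (k - (q + p)) * μ = s * (k - p) * μ - q * (s * μ) by ring,
      Int.sub_mul_emod_self_left]
  have e4 : s * (k - (q + p)) * ν % p = s * (k - q) * ν % p := by
    rw [show s * (k - (q + p)) * ν = s * (k - q) * ν - p * (s * ν) by ring,
      Int.sub_mul_emod_self_left]
  rw [e1, e2, e3, e4]
  exact abs_gridCoeff_rectangle_le ..

/-! ### Kaplan's sum, its bounds and its extremal values -/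

/-- Kaplan's sum for `Φ_{pqr}` when `2` is up to sign the inverse of `r` modulo `p * q`: it runs
over the truncated coefficients of `Φ_{pq}` at the exponents `x + 2 * m` and
`x + 2 * m + 2 * q` with `m < p`. -/
noncomputable def windowSum (p q : ℕ) (K x : ℤ) : ℤ :=
  ∑ m ∈ range p, (truncCoeff (cyclotomic (p * q) ℤ) (p * q : ℕ) K (x + 2 * m) -
    truncCoeff (cyclotomic (p * q) ℤ) (p * q : ℕ) K (x + 2 * m + 2 * q))

lemma windowSum_congr {p q : ℕ} (K : ℤ) {x x' : ℤ} (h : x ≡ x' [ZMOD (p * q : ℕ)]) :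
    windowSum p q K x = windowSum p q K x' := by
  refine sum_congr rfl fun m _ ↦ ?_
  rw [truncCoeff_congr _ K (h.add_right (2 * m)),
    truncCoeff_congr _ K ((h.add_right (2 * m)).add_right (2 * q))]

section Kaplan

variable {p q r : ℕ} {s : ℤ}

lemma intCoeff_cyclotomic_eq_sum_truncCoeff (hp : p.Prime) (hq : q.Prime)
    (hr : r.Prime) (hp2 : 2 < p) (hpq : p < q) (hqr : q < r)
    (hs : s * r ≡ 1 [ZMOD (p * q : ℕ)]) (k : ℤ) :
    intCoeff (cyclotomic (p * q * r) ℤ) k = ∑ m ∈ range p,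
      (truncCoeff (cyclotomic (p * q) ℤ) (p * q : ℕ) (k / r) (s * (k - m))
      - truncCoeff (cyclotomic (p * q) ℤ) (p * q : ℕ) (k / r) (s * (k - (q + m)))) := by
  have hM : p + q ≤ p * q := by nlinarith
  rw [intCoeff_cyclotomic_eq_sum hp hq hr (by omega) (by omega) (by omega) hs]
  refine sum_congr rfl fun m hm ↦ ?_
  have hm' := mem_range.1 hm
  have hr0 : (0 : ℤ) < r := by exact_mod_cast hr.pos
  rw [quotCoeff_sub_eq_truncCoeff _ hr0 hs (by omega) (by omega), sub_sub,
    quotCoeff_sub_eq_truncCoeff _ hr0 hs (by omega) (by omega)]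

lemma intCoeff_cyclotomic_eq_windowSum (hp : p.Prime) (hq : q.Prime)
    (hr : r.Prime) (hp2 : 2 < p) (hpq : p < q) (hqr : q < r)
    (hs : -2 * r ≡ 1 [ZMOD (p * q : ℕ)]) (k : ℤ) :
    intCoeff (cyclotomic (p * q * r) ℤ) k = windowSum p q (k / r) (-2 * k) := by
  rw [intCoeff_cyclotomic_eq_sum_truncCoeff hp hq hr hp2 hpq hqr hs, windowSum]
  refine sum_congr rfl fun m _ ↦ ?_
  congr 2 <;> ring

/-- For the inverse `2` instead of `-2` the window is traversed backwards, and the two halves of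
the sum change places. -/
lemma intCoeff_cyclotomic_eq_neg_windowSum (hp : p.Prime) (hq : q.Prime)
    (hr : r.Prime) (hp2 : 2 < p) (hpq : p < q) (hqr : q < r)
    (hs : 2 * r ≡ 1 [ZMOD (p * q : ℕ)]) (k : ℤ) :
    intCoeff (cyclotomic (p * q * r) ℤ) k =
      -windowSum p q (k / r) (2 * k - 2 * (p - 1) - 2 * q) := by
  rw [intCoeff_cyclotomic_eq_sum_truncCoeff hp hq hr hp2 hpq hqr hs, windowSum,
    ← sum_range_reflect, ← sum_neg_distrib]
  refine sum_congr rfl fun m hm ↦ ?_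
  have hm' := mem_range.1 hm
  rw [neg_sub, Nat.sub_sub, Nat.cast_sub (by omega)]
  push_cast
  congr 2 <;> ring

end Kaplan

section Bounds

lemma sum_range_ite_lt {n a : ℕ} (h : a ≤ n) :
    ∑ m ∈ range n, (if m < a then (1 : ℤ) else 0) = a := by
  rw [sum_boole, ← card_range a]
  congr 2
  ext m
  simp only [mem_filter, mem_range, card_range]
  omega

lemma sum_range_add_emod (f : ℤ → ℤ) (p : ℕ) (y : ℤ) :
    ∑ m ∈ range p, f ((y + m) % p) = ∑ m ∈ range p, f m := by
  have hstep : ∀ y : ℤ, ∑ m ∈ range p, f ((y + 1 + m) % p) = ∑ m ∈ range p, f ((y + m) % p) := by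
    intro y
    have h := sum_range_sub (fun m : ℕ ↦ f ((y + m) % p)) p
    rw [sum_sub_distrib] at h
    simp only [Int.add_emod_right, Nat.cast_zero, add_zero, sub_self] at h
    rw [← sub_eq_zero, ← h]
    congr 1
    refine sum_congr rfl fun m _ ↦ ?_
    push_cast
    congr 2
    ring
  have hzero : ∑ m ∈ range p, f ((0 + m) % p) = ∑ m ∈ range p, f m := by
    refine sum_congr rfl fun m hm ↦ ?_
    have := mem_range.1 hm
    rw [zero_add, Int.emod_eq_of_lt (by omega) (by omega)]
  induction y using Int.induction_on with
  | zero => exact hzero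
  | succ i ih => rw [hstep, ih]
  | pred i ih => rw [← ih, ← hstep, sub_add_cancel]

/-- Raising the coordinate `v` by `2` modulo `p`, which corresponds to raising the exponent by
`2 * q`, changes the coefficient in a direction that depends only on `v < ν`. -/
lemma gridCoeff_sub_gridCoeff_bounds {p q μ ν K u v : ℤ} (hpν : p = 2 * ν - 1) (hν : 3 ≤ ν)
    (hq : 0 ≤ q) (hv0 : 0 ≤ v) (hvp : v < p) :
    (if v < ν then (1 : ℤ) else 0) - 1 ≤
        gridCoeff p q μ ν K u v - gridCoeff p q μ ν K u ((v + 2) % p) ∧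
      gridCoeff p q μ ν K u v - gridCoeff p q μ ν K u ((v + 2) % p) ≤
        if v < ν then (1 : ℤ) else 0 := by
  unfold gridCoeff
  rcases lt_or_ge (v + 2) p with h | h
  · rw [Int.emod_eq_of_lt (by omega) h, add_mul]
    split_ifs <;> omega
  · rw [← Int.sub_emod_right, Int.emod_eq_of_lt (by omega) (by omega)]
    split_ifs <;> omega

variable {p q : ℕ} {μ ν : ℤ}

lemma windowSum_bounds (hp : p.Prime) (hq : q.Prime) (hpq : p ≠ q)
    (hμν : μ * p + ν * q = p * q + 1) (hμ : 0 < μ) (hpν : (p : ℤ) = 2 * ν - 1) (hν : 3 ≤ ν)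
    (K x : ℤ) : ν - p ≤ windowSum p q K x ∧ windowSum p q K x ≤ ν := by
  have hp0 : (0 : ℤ) < p := by exact_mod_cast hp.pos
  have hcount : ∑ m ∈ range p, (if (x * ν + m) % p < ν then (1 : ℤ) else 0) = ν := by
    rw [sum_range_add_emod (fun v ↦ if v < ν then (1 : ℤ) else 0) p]
    have hν' : (ν.toNat : ℤ) = ν := Int.toNat_of_nonneg (by omega)
    conv_rhs => rw [← hν', ← sum_range_ite_lt (n := p) (a := ν.toNat) (by omega)]
    refine sum_congr rfl fun m _ ↦ if_congr ?_ rfl rfl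
    omega
  have hterm : ∀ m ∈ range p,
      (if (x * ν + m) % p < ν then (1 : ℤ) else 0) - 1 ≤
        truncCoeff (cyclotomic (p * q) ℤ) (p * q : ℕ) K (x + 2 * m) -
          truncCoeff (cyclotomic (p * q) ℤ) (p * q : ℕ) K (x + 2 * m + 2 * q) ∧
      truncCoeff (cyclotomic (p * q) ℤ) (p * q : ℕ) K (x + 2 * m) -
          truncCoeff (cyclotomic (p * q) ℤ) (p * q : ℕ) K (x + 2 * m + 2 * q) ≤
        if (x * ν + m) % p < ν then (1 : ℤ) else 0 := by
    intro m _
    simp only [truncCoeff_cyclotomic_eq_gridCoeff_emod hp hq hpq hμν hμ (by omega : 0 < ν)]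
    -- `2 * ν ≡ 1` and `q * ν ≡ 1` modulo `p`
    have e1 : (x + 2 * m) * ν % p = (x * ν + m) % p := by
      rw [show (x + 2 * m) * ν = x * ν + m + p * m by rw [hpν]; ring, Int.add_mul_emod_self_left]
    have e2 : (x + 2 * m + 2 * q) * ν % p = ((x * ν + m) % p + 2) % p := by
      rw [Int.emod_add_emod, show (x + 2 * m + 2 * q) * ν = x * ν + m + 2 + p * (m + 2 * (q - μ)) by
        linear_combination (2 : ℤ) * hμν - m * hpν, Int.add_mul_emod_self_left]
    have e3 : (x + 2 * m + 2 * q) * μ % q = (x + 2 * m) * μ % q := by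
      rw [show (x + 2 * m + 2 * q) * μ = (x + 2 * m) * μ + q * (2 * μ) by ring,
        Int.add_mul_emod_self_left]
    rw [e1, e2, e3]
    exact gridCoeff_sub_gridCoeff_bounds hpν hν (by positivity) (Int.emod_nonneg _ hp0.ne')
      (Int.emod_lt_of_pos _ hp0)
  constructor
  · have := sum_le_sum fun m hm ↦ (hterm m hm).1
    rw [sum_sub_distrib, hcount, sum_const, card_range, nsmul_eq_mul, mul_one] at this
    exact this
  · have := sum_le_sum fun m hm ↦ (hterm m hm).2
    rwa [hcount] at this

end Bounds

section Extremal

variable {p q σ t : ℕ}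

/-- The part of the window up to the truncation point `σ * q` consists of `σ + 1` exponents, and
`Φ_{pq}` has coefficient `1` at each of them. -/
lemma windowSum_eq_max (hp : p.Prime) (hq : q.Prime) (hpq : p < q) (hpσ : p = 2 * σ + 1)
    (hqt : q = p * t + 2) (hσ : 2 ≤ σ) :
    windowSum p q (σ * q) (σ * q - 2 * σ) = σ + 1 := by
  have hpσ' : (p : ℤ) = 2 * σ + 1 := by exact_mod_cast hpσ
  have hqt' : (q : ℤ) = p * t + 2 := by exact_mod_cast hqt
  have hσ' : (2 : ℤ) ≤ σ := by exact_mod_cast hσ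
  have hpq' : (p : ℤ) < q := by exact_mod_cast hpq
  have ht' : (0 : ℤ) ≤ t := by positivity
  rw [← Nat.cast_succ, ← sum_range_ite_lt (n := p) (a := σ + 1) (by omega), windowSum]
  refine sum_congr rfl fun m hm ↦ ?_
  have hm' := mem_range.1 hm
  have hmp : (m : ℤ) < p := by exact_mod_cast hm'
  have hlarge : (σ * q + 2 * σ + 2 * q : ℤ) < p * q := by nlinarith
  have hσq : (2 * σ : ℤ) ≤ σ * q := by nlinarith
  rw [truncCoeff_eq_zero _ (j := σ * q - 2 * σ + 2 * m + 2 * q) (by omega)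
    (by push_cast; omega) (by omega), sub_zero]
  split_ifs with hmσ
  · have hmσ' : (m : ℤ) ≤ σ := by omega
    have htσ : (0 : ℤ) ≤ t * (σ - m) := mul_nonneg ht' (by omega)
    have htσ' : (t * (σ - m) : ℤ) ≤ t * σ := by nlinarith
    have hexp : (σ * q - 2 * σ + 2 * m : ℤ) = t * (σ - m) * p + m * q := by
      linear_combination (σ - m : ℤ) * hqt'
    rw [truncCoeff_cyclotomic_eq_gridCoeff (μ := σ * t + 1) (ν := σ + 1) hp hq hpq.ne
      (by rw [hqt', hpσ']; ring) (by positivity) (by positivity) htσ (by nlinarith)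
      (Int.natCast_nonneg m) hmp _ (by rw [hexp]), gridCoeff, ← hexp,
      if_pos (by linarith), if_pos (by omega), if_pos (by omega)]
  · exact truncCoeff_eq_zero _ (by omega) (by push_cast; omega) (by omega)

/-- The exponents of this window are those of `windowSum_eq_max` lowered by `1`. Up to the
truncation point the first has coefficient `0` and the other `σ` have coefficient `-1`. -/
lemma windowSum_eq_min (hp : p.Prime) (hq : q.Prime) (hpq : p < q) (hpσ : p = 2 * σ + 1)
    (hqt : q = p * t + 2) (hσ : 2 ≤ σ) :
    windowSum p q (σ * q - 1) (σ * q - 2 * σ - 1) = -σ := by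
  have hpσ' : (p : ℤ) = 2 * σ + 1 := by exact_mod_cast hpσ
  have hqt' : (q : ℤ) = p * t + 2 := by exact_mod_cast hqt
  have hσ' : (2 : ℤ) ≤ σ := by exact_mod_cast hσ
  have hpq' : (p : ℤ) < q := by exact_mod_cast hpq
  have ht' : (0 : ℤ) ≤ t := by positivity
  have hμν : ((σ * t + 1 : ℤ) * p + (σ + 1) * q) = p * q + 1 := by rw [hqt', hpσ']; ring
  have hsum : (-σ : ℤ) = ∑ m ∈ range p,
      ((if m < 1 then (1 : ℤ) else 0) - (if m < σ + 1 then (1 : ℤ) else 0)) := by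
    rw [sum_sub_distrib, sum_range_ite_lt (by omega), sum_range_ite_lt (by omega)]
    push_cast
    ring
  rw [hsum, windowSum]
  refine sum_congr rfl fun m hm ↦ ?_
  have hm' := mem_range.1 hm
  have hmp : (m : ℤ) < p := by exact_mod_cast hm'
  have hlarge : (σ * q + 2 * σ + 2 * q : ℤ) < p * q := by nlinarith
  have hσq : (2 * σ + 1 : ℤ) ≤ σ * q := by nlinarith
  rw [truncCoeff_eq_zero _ (j := σ * q - 2 * σ - 1 + 2 * m + 2 * q) (by omega)
    (by push_cast; omega) (by omega), sub_zero]
  have hqσt : (q : ℤ) = 2 * (σ * t) + t + 2 := by rw [hqt', hpσ']; ring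
  have hσt : (0 : ℤ) ≤ σ * t := by positivity
  rcases Nat.eq_zero_or_pos m with rfl | hm0
  · rw [if_pos (by omega), if_pos (by omega), sub_self,
      truncCoeff_cyclotomic_eq_gridCoeff (μ := σ * t + 1) (ν := σ + 1) (u := q - 1) (v := σ)
      hp hq hpq.ne hμν (by positivity) (by positivity) (by omega) (by omega)
      (by omega) (by omega) _ ?_, gridCoeff, if_neg (by omega), if_pos (by omega)]
    refine Int.modEq_iff_dvd.2 ⟨1, ?_⟩
    push_cast
    linear_combination -hpσ'
  · rw [if_neg (by omega), zero_sub]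
    split_ifs with hmσ
    · have hmσ' : (m : ℤ) ≤ σ := by omega
      have htσ : (0 : ℤ) ≤ t * (σ - m) := mul_nonneg ht' (by omega)
      have htσ' : (t * (σ - m) : ℤ) ≤ t * σ := by nlinarith
      have hexp : ((t * (σ - m) - (σ * t + 1) + q) * p + (m + σ) * q - p * q : ℤ) =
          σ * q - 2 * σ - 1 + 2 * m := by
        linear_combination -hμν - (σ - m : ℤ) * hqt' - (q : ℤ) * hpσ'
      rw [truncCoeff_cyclotomic_eq_gridCoeff (μ := σ * t + 1) (ν := σ + 1)
        (u := t * (σ - m) - (σ * t + 1) + q) (v := m + σ) hp hq hpq.ne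
        hμν (by positivity) (by positivity) (by omega) (by linarith)
        (by positivity) (by omega) _ ?_, gridCoeff, if_neg (by omega), if_neg (by omega),
        if_pos (by omega)]
      refine Int.modEq_iff_dvd.2 ⟨1, ?_⟩
      push_cast
      linarith
    · rw [neg_zero]
      exact truncCoeff_eq_zero _ (by omega) (by push_cast; omega) (by omega)

end Extremal

/-! ### The coefficient set -/

/-- A discrete intermediate value theorem for steps of size at most one. -/
lemma exists_eq_of_abs_sub_le_one {f : ℕ → ℤ} (hf : ∀ k, |f (k + 1) - f k| ≤ 1) {a b : ℕ}
    (hab : a ≤ b) {c : ℤ} (ha : f a ≤ c) (hb : c ≤ f b) : ∃ k ∈ Set.Icc a b, f k = c := by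
  induction b, hab using Nat.le_induction with
  | base => exact ⟨a, ⟨le_rfl, le_rfl⟩, le_antisymm ha hb⟩
  | succ b hab ih =>
    rcases le_or_gt c (f b) with h | h
    · obtain ⟨k, hk, hkc⟩ := ih h
      exact ⟨k, ⟨hk.1, hk.2.trans b.le_succ⟩, hkc⟩
    · have := abs_le.1 (hf b)
      exact ⟨b + 1, ⟨by omega, le_rfl⟩, by omega⟩

lemma cyclotomicCoeff_eq_intCoeff (n k : ℕ) :
    cyclotomicCoeff n k = intCoeff (cyclotomic n ℤ) k :=
  (intCoeff_natCast _ _).symm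

/-- If the coefficients lie in `[L, H]`, move in steps of at most one, and take the values `L` and
`H` at `a` and `b`, then all values in `[L, H]` occur between `a` and `b`. -/
lemma cyclotomicCoeffSet_eq_of_extremal {n a b : ℕ} {L H : ℤ}
    (hstep : ∀ k, |cyclotomicCoeff n (k + 1) - cyclotomicCoeff n k| ≤ 1)
    (hbound : ∀ k, cyclotomicCoeff n k ∈ Set.Icc L H) (hab : a ≤ b)
    (hb : cyclotomicCoeff n b ≠ 0)
    (hval : (cyclotomicCoeff n a = L ∧ cyclotomicCoeff n b = H) ∨
      (cyclotomicCoeff n a = H ∧ cyclotomicCoeff n b = L)) :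
    cyclotomicCoeffSet n = cyclotomicCoeff n '' Set.Icc a b ∧
      cyclotomicCoeff n '' Set.Icc a b = Set.Icc L H := by
  have hdeg : b ≤ (cyclotomic n ℤ).natDegree := le_natDegree_of_ne_zero hb
  have h1 : Set.Icc L H ⊆ cyclotomicCoeff n '' Set.Icc a b := by
    intro c hc
    rcases hval with ⟨ha, hb⟩ | ⟨ha, hb⟩
    · exact exists_eq_of_abs_sub_le_one hstep hab (ha.trans_le hc.1) (hc.2.trans_eq hb.symm)
    · obtain ⟨k, hk, hkc⟩ := exists_eq_of_abs_sub_le_one (f := fun k ↦ -cyclotomicCoeff n k)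
        (c := -c) (fun k ↦ by rw [neg_sub_neg, abs_sub_comm]; exact hstep k) hab
        (by rw [ha]; exact neg_le_neg hc.2) (by rw [hb]; exact neg_le_neg hc.1)
      exact ⟨k, hk, neg_injective hkc⟩
  have h2 : cyclotomicCoeff n '' Set.Icc a b ⊆ cyclotomicCoeffSet n := by
    rintro _ ⟨k, hk, rfl⟩
    exact ⟨k, hk.2.trans hdeg, rfl⟩
  have h3 : cyclotomicCoeffSet n ⊆ Set.Icc L H := by
    rintro _ ⟨k, _, rfl⟩
    exact hbound k
  exact ⟨(h3.trans h1).antisymm h2, (h2.trans h3).antisymm h1⟩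

lemma isCoefficientOptimal_of_eq_Icc {p q r : ℕ} {L H : ℤ}
    (h : cyclotomicCoeffSet (p * q * r) = Set.Icc L H) (hLH : H - L = p) :
    IsCoefficientOptimal p q r := by
  have : L ≤ H := by omega
  exact ⟨H, L, h ▸ isGreatest_Icc this, h ▸ isLeast_Icc this, hLH⟩

lemma modEq_mul_of_modEq {p q : ℕ} (hp : p.Prime) (hq : q.Prime) (hpq : p ≠ q) {a b : ℤ}
    (h1 : a ≡ b [ZMOD p]) (h2 : a ≡ b [ZMOD q]) : a ≡ b [ZMOD (p * q : ℕ)] := by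
  push_cast
  refine (Int.modEq_and_modEq_iff_modEq_mul ?_).1 ⟨h1, h2⟩
  simpa using (Nat.coprime_primes hp hq).2 hpq

end

theorem theorem2 (p q : ℕ) (hp : p.Prime) (hq : q.Prime) (hp3 : 3 < p) (hpq : p < q)
    (hqp : q ≡ 2 [MOD p]) :
    (∀ r k : ℕ, r.Prime → q < r → r ≡ (p - 1) / 2 [MOD p] → r ≡ (q - 1) / 2 [MOD q] →
      k = (p - 1) * (q * r + 1) / 2 →
      IsCoefficientOptimal p q r ∧
      cyclotomicCoeffSet (p * q * r) = cyclotomicCoeff (p * q * r) '' Set.Icc (k - r) k ∧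
      cyclotomicCoeff (p * q * r) '' Set.Icc (k - r) k =
        Set.Icc (-(((p : ℤ) - 1) / 2)) (((p : ℤ) + 1) / 2)) ∧
    (∀ r₁ k₁ : ℕ, r₁.Prime → q < r₁ → r₁ ≡ (p + 1) / 2 [MOD p] → r₁ ≡ (q + 1) / 2 [MOD q] →
      k₁ = (p - 1) * (q * r₁ + 1) / 2 + q →
      IsCoefficientOptimal p q r₁ ∧
      cyclotomicCoeffSet (p * q * r₁) =
        cyclotomicCoeff (p * q * r₁) '' Set.Icc (k₁ - r₁) k₁ ∧
      cyclotomicCoeff (p * q * r₁) '' Set.Icc (k₁ - r₁) k₁ =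
        Set.Icc (-(((p : ℤ) + 1) / 2)) (((p : ℤ) - 1) / 2)) := by
  obtain ⟨σ, hpσ⟩ : ∃ σ, p = 2 * σ + 1 := hp.odd_of_ne_two (by omega)
  obtain ⟨τ, hqτ⟩ : ∃ τ, q = 2 * τ + 1 := hq.odd_of_ne_two (by omega)
  obtain ⟨t, hqt⟩ : ∃ t, q = p * t + 2 := by
    obtain ⟨t, ht⟩ := (Nat.modEq_iff_dvd' (by omega)).1 hqp.symm
    exact ⟨t, by omega⟩
  have hσ : 2 ≤ σ := by omega
  have hpσ' : (p : ℤ) = 2 * σ + 1 := by exact_mod_cast hpσ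
  have hqt' : (q : ℤ) = p * t + 2 := by exact_mod_cast hqt
  have hμν : ((σ * t + 1 : ℤ) * p + (σ + 1) * q) = p * q + 1 := by rw [hqt', hpσ']; ring
  have hbd := windowSum_bounds hp hq hpq.ne hμν (by positivity) (by omega) (by omega)
  have hmax := windowSum_eq_max hp hq hpq hpσ hqt hσ
  have hmin := windowSum_eq_min hp hq hpq hpσ hqt hσ
  have hσq : 1 ≤ σ * q := Nat.mul_pos (by omega) hq.pos
  have hk0 : ∀ r : ℕ, (p - 1) * (q * r + 1) / 2 = r * (σ * q) + σ := by
    intro r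
    rw [show p - 1 = 2 * σ by omega, mul_assoc, Nat.mul_div_cancel_left _ two_pos]
    ring
  have hstep : ∀ {r : ℕ} {s : ℤ}, r.Prime → q < r → s * r ≡ 1 [ZMOD (p * q : ℕ)] → ∀ k : ℕ,
      |cyclotomicCoeff (p * q * r) (k + 1) - cyclotomicCoeff (p * q * r) k| ≤ 1 := by
    intro r s hr hqr hs k
    have := abs_intCoeff_cyclotomic_sub_le hp hq hr hpq.ne (by omega) hqr.ne hs hμν
      (by positivity) (by positivity) (k + 1 : ℕ)
    rw [cyclotomicCoeff_eq_intCoeff, cyclotomicCoeff_eq_intCoeff]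
    rwa [Nat.cast_succ, add_sub_cancel_right] at this
  constructor
  · intro r k hr hqr hrp hrq hk
    rw [hk0] at hk
    have hs : -2 * (r : ℤ) ≡ 1 [ZMOD (p * q : ℕ)] := by
      apply modEq_mul_of_modEq hp hq hpq.ne
      · have h := (Int.natCast_modEq_iff.2 hrp).mul_left (-2)
        rw [show (p - 1) / 2 = σ by omega] at h
        exact h.trans (Int.modEq_iff_dvd.2 ⟨1, by linarith⟩)
      · have h := (Int.natCast_modEq_iff.2 hrq).mul_left (-2)
        rw [show (q - 1) / 2 = τ by omega] at h
        exact h.trans (Int.modEq_iff_dvd.2 ⟨1, by omega⟩)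
    have hcoeff : ∀ k : ℕ, cyclotomicCoeff (p * q * r) k = windowSum p q (k / r) (-2 * k) :=
      fun k ↦ (cyclotomicCoeff_eq_intCoeff _ _).trans
        (intCoeff_cyclotomic_eq_windowSum hp hq hr (by omega) hpq hqr hs k)
    have hrk : r ≤ k := by nlinarith
    have hr0 : (r : ℤ) ≠ 0 := by exact_mod_cast hr.ne_zero
    have hkdiv : (k : ℤ) / r = σ * q := by
      rw [hk]
      push_cast
      rw [Int.mul_add_ediv_left _ _ hr0, Int.ediv_eq_zero_of_lt (by omega) (by omega), add_zero]
    have hkmod : -2 * (k : ℤ) ≡ σ * q - 2 * σ [ZMOD (p * q : ℕ)] := by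
      have h := (hs.mul_left (σ * q : ℤ)).sub_right (2 * σ : ℤ)
      convert h using 1
      · rw [hk]; push_cast; ring
      · ring
    have hvalk : cyclotomicCoeff (p * q * r) k = σ + 1 := by
      rw [hcoeff, hkdiv, windowSum_congr _ hkmod, hmax]
    have hvalkr : cyclotomicCoeff (p * q * r) (k - r) = -σ := by
      have hdiv : ((k : ℤ) - r) / r = σ * q - 1 := by
        rw [Int.sub_ediv_of_dvd _ dvd_rfl, Int.ediv_self hr0, hkdiv]
      have hmod : -2 * ((k : ℤ) - r) ≡ σ * q - 2 * σ - 1 [ZMOD (p * q : ℕ)] := by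
        rw [show -2 * ((k : ℤ) - r) = -2 * k - -2 * r by ring]
        exact hkmod.sub hs
      rw [hcoeff, Nat.cast_sub hrk, hdiv, windowSum_congr _ hmod, hmin]
    have hmain := cyclotomicCoeffSet_eq_of_extremal (L := -(((p : ℤ) - 1) / 2))
      (H := ((p : ℤ) + 1) / 2) (hstep hr hqr hs)
      (fun k ↦ by
        have := hbd (k / r) (-2 * k)
        rw [hcoeff]
        exact ⟨by omega, by omega⟩) (Nat.sub_le k r) (by rw [hvalk]; positivity)
      (Or.inl ⟨by omega, by omega⟩)
    exact ⟨isCoefficientOptimal_of_eq_Icc (hmain.1.trans hmain.2) (by omega), hmain⟩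
  · intro r k hr hqr hrp hrq hk
    rw [hk0] at hk
    have hs : 2 * (r : ℤ) ≡ 1 [ZMOD (p * q : ℕ)] := by
      apply modEq_mul_of_modEq hp hq hpq.ne
      · have h := (Int.natCast_modEq_iff.2 hrp).mul_left 2
        rw [show (p + 1) / 2 = σ + 1 by omega] at h
        exact h.trans (Int.modEq_iff_dvd.2 ⟨-1, by push_cast; linarith⟩)
      · have h := (Int.natCast_modEq_iff.2 hrq).mul_left 2
        rw [show (q + 1) / 2 = τ + 1 by omega] at h
        exact h.trans (Int.modEq_iff_dvd.2 ⟨-1, by omega⟩)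
    have hcoeff : ∀ k : ℕ, cyclotomicCoeff (p * q * r) k =
        -windowSum p q (k / r) (2 * k - 2 * (p - 1) - 2 * q) :=
      fun k ↦ (cyclotomicCoeff_eq_intCoeff _ _).trans
        (intCoeff_cyclotomic_eq_neg_windowSum hp hq hr (by omega) hpq hqr hs k)
    have hrk : r ≤ k := by nlinarith
    have hr0 : (r : ℤ) ≠ 0 := by exact_mod_cast hr.ne_zero
    -- `p * q` divides `2 * r - 1`, so `r` is large enough for `k / r` to be `σ * q`
    have hrlarge : (σ + q : ℤ) < r := by
      have hle := Int.le_of_dvd (by omega) hs.symm.dvd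
      push_cast at hle
      nlinarith
    have hkdiv : (k : ℤ) / r = σ * q := by
      rw [hk]
      push_cast
      rw [add_assoc, Int.mul_add_ediv_left _ _ hr0,
        Int.ediv_eq_zero_of_lt (by omega) (by omega), add_zero]
    have hkmod : 2 * (k : ℤ) - 2 * (p - 1) - 2 * q ≡ σ * q - 2 * σ [ZMOD (p * q : ℕ)] := by
      have h := (hs.mul_left (σ * q : ℤ)).sub_right (2 * σ : ℤ)
      convert h using 1
      · rw [hk, hpσ']; push_cast; ring
      · ring
    have hvalk : cyclotomicCoeff (p * q * r) k = -(σ + 1) := by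
      rw [hcoeff, hkdiv, windowSum_congr _ hkmod, hmax]
    have hvalkr : cyclotomicCoeff (p * q * r) (k - r) = σ := by
      have hdiv : ((k : ℤ) - r) / r = σ * q - 1 := by
        rw [Int.sub_ediv_of_dvd _ dvd_rfl, Int.ediv_self hr0, hkdiv]
      have hmod : 2 * ((k : ℤ) - r) - 2 * (p - 1) - 2 * q ≡ σ * q - 2 * σ - 1
          [ZMOD (p * q : ℕ)] := by
        rw [show 2 * ((k : ℤ) - r) - 2 * (p - 1) - 2 * q =
          2 * k - 2 * (p - 1) - 2 * q - 2 * r by ring]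
        exact hkmod.sub hs
      rw [hcoeff, Nat.cast_sub hrk, hdiv, windowSum_congr _ hmod, hmin, neg_neg]
    have hmain := cyclotomicCoeffSet_eq_of_extremal (L := -(((p : ℤ) + 1) / 2))
      (H := ((p : ℤ) - 1) / 2) (hstep hr hqr hs)
      (fun k ↦ by
        have := hbd (k / r) (2 * k - 2 * (p - 1) - 2 * q)
        rw [hcoeff]
        exact ⟨by omega, by omega⟩) (Nat.sub_le k r) (by omega)
      (Or.inr ⟨by omega, by omega⟩)
    exact ⟨isCoefficientOptimal_of_eq_Icc (hmain.1.trans hmain.2) (by omega), hmain⟩
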